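/- Let $G$ be a finite directed acyclic graph (multiple edges allowed) with vertices $s<1<\dots<n<t$, all of whose edges go from a smaller to a larger vertex, with unique source $s$ and unique sink $t$; the other vertices are called inner. Write $\mathrm{in}(v)$ and $\mathrm{out}(v)$ for the sets of edges into and out of $v$. Assume that $G$ has no idle edge, i.e. no edge is the only incoming or the only outgoing edge of an inner vertex. A route is a directed path from $s$ to $t$, with indicator vector $\chi_R\in\mathbb{R}^{E(G)}$. The flow polytope $\mathcal{F}_1(G)$ is the set of all $x\in\mathbb{R}_{\ge 0}^{E(G)}$ with $\sum_{e\in\mathrm{in}(v)}x_e=\sum_{e\in\mathrm{out}(v)}x_e$ for all inner $v$ and $\sum_{e\in\mathrm{out}(s)}x_e=1$. A framing $F$ of $G$ is a choice of linear orders on $\mathrm{in}(v)$ and $\mathrm{out}(v)$ for each inner vertex $v$. Paths from $s$ to $v$ are compared by $F$ at the vertex where their longest common final segment begins, by the edges of the two paths into this vertex; paths from $v$ to $t$ are compared at the vertex where their longest common initial segment ends, by the edges of the two paths out of this vertex. Two routes $P,Q$ conflict if, for some common inner vertex $v$ and up to exchanging $P$ and $Q$, the part of $P$ before $v$ is smaller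 than that of $Q$ while the part of $P$ after $v$ is larger than that of $Q$; otherwise they are coherent. The DKK triangulation of $\mathcal{F}_1(G)$ induced by $F$ consists of the simplices $\mathrm{conv}\{\chi_R:R\in C\}$, for $C$ a maximal set of pairwise coherent routes, and all their faces. Let $\mathcal{R}$ be a route decomposition of $G$, i.e. a set of routes such that $E(G)$ is the disjoint union of their edge sets, equipped with a linear order. Let $\Delta_\mathcal{R}=\mathrm{conv}\{\chi_R:R\in\mathcal{R}\}$. Let $\Gamma$ be the complex generated by the faces $\bigcap_{R\in\mathcal{R}}F_R$, where each $F_R$ is a facet of $\mathcal{F}_1(G)$ with $\chi_R\notin F_R$. Let $T_{\mathrm{eq}}$ be the set of those simplices that are contained in a face of $\Gamma$ in the DKK triangulation induced by the framing in which the edges into, respectively out of, an inner vertex are ordered like the routes of $\mathcal{R}$ containing them. The equatorial flow triangulation $T_{\mathrm{eq}}*\Delta_\mathcal{R}$ consists of the simplices $\mathrm{conv}(\sigma\cup\Delta_\mathcal{R})$, $\sigma\in T_{\mathrm{eq}}$ (including $\sigma=\emptyset$), and all their faces. Theorem. Suppose that $G$ has an inner vertex of indegree at least $3$. Then, for every route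 decomposition $\mathcal{R}$ of $G$ and every linear order on $\mathcal{R}$, the equatorial flow triangulation $T_{\mathrm{eq}}*\Delta_\mathcal{R}$ is not the DKK triangulation of $\mathcal{F}_1(G)$ induced by any framing of $G$. Moreover, for every $R\in\mathcal{R}$ the vector $\chi_R$ is a vertex of every maximal simplex of $T_{\mathrm{eq}}*\Delta_\mathcal{R}$, whereas for every framing $F$ of $G$ some route $R\in\mathcal{R}$ conflicts under $F$ with some route of $G$. -/

import Mathlib

/-- A finite directed acyclic multigraph on the vertices `s = 0 < 1 < ⋯ < n < n + 1 = t`, with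
edges labelled by `E`, each going from a smaller to a larger vertex, such that `s` is the only
source and `t` is the only sink. -/
structure FlowDAG (n : ℕ) (E : Type*) where
  src : E → Fin (n + 2)
  tgt : E → Fin (n + 2)
  src_lt_tgt : ∀ e, src e < tgt e
  unique_source : ∀ v, v ≠ 0 → ∃ e, tgt e = v
  unique_sink : ∀ v, v ≠ Fin.last (n + 1) → ∃ e, src e = v

namespace FlowDAG

variable {n : ℕ} {E : Type*}

/-- The inner vertices: all vertices except the source and the sink. -/
abbrev Inner (_G : FlowDAG n E) : Type := {v : Fin (n + 2) // v ≠ 0 ∧ v ≠ Fin.last (n + 1)}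

/-- The edges coming into `v`. -/
def inEdges [Fintype E] (G : FlowDAG n E) (v : Fin (n + 2)) : Finset E :=
  Finset.univ.filter fun e => G.tgt e = v

/-- The edges going out of `v`. -/
def outEdges [Fintype E] (G : FlowDAG n E) (v : Fin (n + 2)) : Finset E :=
  Finset.univ.filter fun e => G.src e = v

/-- An edge is idle if it is the only incoming or the only outgoing edge of an inner vertex. -/
def IsIdle [Fintype E] (G : FlowDAG n E) (e : E) : Prop :=
  ∃ v : G.Inner, G.inEdges v = {e} ∨ G.outEdges v = {e}

/-- `G.IsPath u l w`: the list of edges `l` is a directed path from `u` to `w`. -/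
def IsPath (G : FlowDAG n E) : Fin (n + 2) → List E → Fin (n + 2) → Prop
  | u, [], w => u = w
  | u, e :: l, w => G.src e = u ∧ G.IsPath (G.tgt e) l w

/-- A route is a directed path from the source to the sink. -/
abbrev Route (G : FlowDAG n E) : Type _ := {l : List E // G.IsPath 0 l (Fin.last (n + 1))}

/-- The indicator vector of a route. -/
noncomputable def chi (G : FlowDAG n E) (R : G.Route) : E → ℝ :=
  Set.indicator {e | e ∈ R.1} 1

/-- The flow polytope of unit flows. -/
def flowPolytope [Fintype E] (G : FlowDAG n E) : Set (E → ℝ) :=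
  {x | (∀ e, 0 ≤ x e) ∧
    (∀ v : G.Inner, ∑ e ∈ G.inEdges v, x e = ∑ e ∈ G.outEdges v, x e) ∧
    ∑ e ∈ G.outEdges 0, x e = 1}

/-- A framing: at each inner vertex `v`, linear orders on the sets of incoming and of outgoing
edges. -/
structure Framing (G : FlowDAG n E) where
  inOrder : ∀ v : G.Inner, LinearOrder {e : E // G.tgt e = v}
  outOrder : ∀ v : G.Inner, LinearOrder {e : E // G.src e = v}

namespace Framing

variable {G : FlowDAG n E}

/-- The order on paths `p`, `q` that end at the same inner vertex: `p` is below `q` if, with `c`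
their common final segment, starting at the inner vertex `w`, the edge of `p` into `w` is smaller
than the edge of `q` into `w`. -/
def InLT (F : G.Framing) (p q : List E) : Prop :=
  ∃ (w : G.Inner) (e f : {e : E // G.tgt e = w}) (p' q' c : List E),
    p = p' ++ e.1 :: c ∧ q = q' ++ f.1 :: c ∧ (F.inOrder w).lt e f

/-- The order on paths `p`, `q` that start at the same inner vertex: `p` is below `q` if, with `c`
their common initial segment, ending at the inner vertex `w`, the edge of `p` out of `w` is smaller
than the edge of `q` out of `w`. -/
def OutLT (F : G.Framing) (p q : List E) : Prop :=
  ∃ (w : G.Inner) (e f : {e : E // G.src e = w}) (c p' q' : List E),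
    p = c ++ e.1 :: p' ∧ q = c ++ f.1 :: q' ∧ (F.outOrder w).lt e f

/-- `P` and `Q` conflict at their common inner vertex `v`; here `P₁`, `P₂` are the parts of `P`
before and after `v`, and similarly for `Q`. -/
def ConflictAt (F : G.Framing) (v : G.Inner) (P Q : G.Route) : Prop :=
  ∃ P₁ P₂ Q₁ Q₂ : List E,
    P.1 = P₁ ++ P₂ ∧ G.IsPath 0 P₁ v ∧ G.IsPath v P₂ (Fin.last (n + 1)) ∧
    Q.1 = Q₁ ++ Q₂ ∧ G.IsPath 0 Q₁ v ∧ G.IsPath v Q₂ (Fin.last (n + 1)) ∧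
    ((F.InLT P₁ Q₁ ∧ F.OutLT Q₂ P₂) ∨ (F.InLT Q₁ P₁ ∧ F.OutLT P₂ Q₂))

/-- Two routes are in conflict if they conflict at some common inner vertex. -/
def Conflict (F : G.Framing) (P Q : G.Route) : Prop := ∃ v : G.Inner, F.ConflictAt v P Q

/-- Two routes are coherent if they conflict at no common inner vertex. -/
def Coherent (F : G.Framing) (P Q : G.Route) : Prop := ¬ F.Conflict P Q

/-- A clique is a set of pairwise coherent routes. -/
def IsClique (F : G.Framing) (C : Set G.Route) : Prop := C.Pairwise F.Coherent

end Framing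

/-- `A` is a facet of the polytope `P`: a maximal proper face of `P`. (The faces of a polytope,
the empty one included, are its exposed subsets.) -/
def IsFacet (P A : Set (E → ℝ)) : Prop :=
  Maximal (fun B => IsExposed ℝ P B ∧ B ≠ P) A

/-- The family of all faces (the empty one included) of the polytopes in `S`; if the polytopes in
`S` meet face to face, this is the polyhedral complex generated by `S`. -/
def generatedComplex (S : Set (Set (E → ℝ))) : Set (Set (E → ℝ)) :=
  {B | ∃ A ∈ S, IsExposed ℝ A B}

/-- The DKK triangulation induced by a framing, as the set of all its simplices: it is generated
by the simplices spanned by the maximal cliques. -/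
def Framing.dkkTriangulation {G : FlowDAG n E} (F : G.Framing) : Set (Set (E → ℝ)) :=
  generatedComplex {A | ∃ C : Set G.Route, Maximal F.IsClique C ∧ A = convexHull ℝ (G.chi '' C)}

/-- A route decomposition: a set of routes such that the edge set is the disjoint union of the
edge sets of these routes. -/
structure RouteDecomposition (G : FlowDAG n E) where
  routes : Set G.Route
  existsUnique_route : ∀ e : E, ∃! R : G.Route, R ∈ routes ∧ e ∈ R.1

theorem IsPath.le_src {G : FlowDAG n E} : ∀ {l : List E} {u w : Fin (n + 2)},
    G.IsPath u l w → ∀ e ∈ l, u ≤ G.src e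
  | [], _, _, _, e, he => by simp at he
  | a :: l, u, w, h, e, he => by
    obtain ⟨h1, h2⟩ := h
    rcases List.mem_cons.1 he with rfl | he
    · exact h1.ge
    · exact h1 ▸ (G.src_lt_tgt a).le.trans (h2.le_src e he)

/-- A path has at most one edge into each vertex. -/
theorem IsPath.eq_of_tgt_eq {G : FlowDAG n E} : ∀ {l : List E} {u w : Fin (n + 2)},
    G.IsPath u l w → ∀ e ∈ l, ∀ f ∈ l, G.tgt e = G.tgt f → e = f
  | [], _, _, _, e, he, _, _, _ => by simp at he
  | a :: l, u, w, h, e, he, f, hf, hef => by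
    obtain ⟨_, h2⟩ := h
    have key : ∀ x ∈ l, G.tgt a < G.tgt x := fun x hx =>
      (h2.le_src x hx).trans_lt (G.src_lt_tgt x)
    rcases List.mem_cons.1 he with h3 | h3 <;> rcases List.mem_cons.1 hf with h4 | h4
    · exact h3.trans h4.symm
    · exact absurd (h3 ▸ hef) (key f h4).ne
    · exact absurd (h4 ▸ hef) (key e h3).ne'
    · exact h2.eq_of_tgt_eq e h3 f h4 hef

/-- A path has at most one edge out of each vertex. -/
theorem IsPath.eq_of_src_eq {G : FlowDAG n E} : ∀ {l : List E} {u w : Fin (n + 2)},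
    G.IsPath u l w → ∀ e ∈ l, ∀ f ∈ l, G.src e = G.src f → e = f
  | [], _, _, _, e, he, _, _, _ => by simp at he
  | a :: l, u, w, h, e, he, f, hf, hef => by
    obtain ⟨_, h2⟩ := h
    have key : ∀ x ∈ l, G.src a < G.src x := fun x hx =>
      (G.src_lt_tgt a).trans_le (h2.le_src x hx)
    rcases List.mem_cons.1 he with h3 | h3 <;> rcases List.mem_cons.1 hf with h4 | h4
    · exact h3.trans h4.symm
    · exact absurd (h3 ▸ hef) (key f h4).ne
    · exact absurd (h4 ▸ hef) (key e h3).ne'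
    · exact h2.eq_of_src_eq e h3 f h4 hef

namespace RouteDecomposition

variable {G : FlowDAG n E} (D : G.RouteDecomposition)

/-- The route of the decomposition that contains the edge `e`. -/
noncomputable def routeOf (e : E) : D.routes :=
  ⟨(D.existsUnique_route e).choose, (D.existsUnique_route e).choose_spec.1.1⟩

theorem mem_routeOf (e : E) : e ∈ (D.routeOf e).1.1 :=
  (D.existsUnique_route e).choose_spec.1.2

/-- The route decomposition framing: edges at an inner vertex are ordered like the routes of the
decomposition that contain them. -/
noncomputable def framing [LinearOrder D.routes] : G.Framing where
  inOrder v := LinearOrder.lift' (fun e : {e : E // G.tgt e = v} => D.routeOf e.1) <| by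
    intro e f h
    have h' : D.routeOf e.1 = D.routeOf f.1 := h
    exact Subtype.ext ((D.routeOf e.1).1.2.eq_of_tgt_eq e.1 (D.mem_routeOf e.1) f.1
      (h' ▸ D.mem_routeOf f.1) (e.2.trans f.2.symm))
  outOrder v := LinearOrder.lift' (fun e : {e : E // G.src e = v} => D.routeOf e.1) <| by
    intro e f h
    have h' : D.routeOf e.1 = D.routeOf f.1 := h
    exact Subtype.ext ((D.routeOf e.1).1.2.eq_of_src_eq e.1 (D.mem_routeOf e.1) f.1
      (h' ▸ D.mem_routeOf f.1) (e.2.trans f.2.symm))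

/-- The route simplex. -/
def routeSimplex : Set (E → ℝ) := convexHull ℝ (G.chi '' D.routes)

/-- The equatorial complex of the flow polytope: generated by the intersections of facets `A R`,
one for each route `R` of the decomposition, such that `A R` does not contain the indicator vector
of `R`. -/
def equatorialComplex [Fintype E] : Set (Set (E → ℝ)) :=
  generatedComplex {B | ∃ A : D.routes → Set (E → ℝ),
    (∀ R, IsFacet G.flowPolytope (A R) ∧ G.chi R.1 ∉ A R) ∧ B = ⋂ R, A R}

/-- The restriction to the equatorial complex of the DKK triangulation of the route decomposition
framing: all its simplices that lie in a face of the equatorial complex. -/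
def equatorialRestriction [Fintype E] [LinearOrder D.routes] : Set (Set (E → ℝ)) :=
  {σ | σ ∈ D.framing.dkkTriangulation ∧ ∃ B ∈ D.equatorialComplex, σ ⊆ B}

/-- The equatorial flow triangulation, as the set of all its simplices: the join of the
equatorial restriction with the route simplex. -/
def equatorialFlowTriangulation [Fintype E] [LinearOrder D.routes] : Set (Set (E → ℝ)) :=
  generatedComplex {A | ∃ σ ∈ D.equatorialRestriction, A = convexHull ℝ (σ ∪ D.routeSimplex)}

end RouteDecomposition

end FlowDAG

namespace FlowDAG

variable {n : ℕ} {E : Type*} {G : FlowDAG n E}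

/-! The two triangulations are told apart by the vertices common to all their maximal simplices. In
the join, every maximal simplex has each `χ_R` with `R ∈ D.routes` as a vertex
(`chi_mem_extremePoints_of_maximal`). On the DKK side every route `Q` lies in a maximal clique, and
this clique spans a maximal simplex (`maximal_convexHull_chi`). If the two agreed, each `R ∈
D.routes` would therefore be coherent with every other route.

This fails at an inner vertex `v` with three incoming edges (`exists_conflict_of_lt_lt`). For any
framing, let `e` be an incoming edge lying strictly between two others, `R` the route of the
decomposition through `e`, and `f` its edge out of `v`. Since `f` is not idle, there is another edge
`f'` out of `v`. If `f' < f`, a route entering by an edge above `e` and leaving by `f'` conflicts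
with `R`; if `f' > f`, one entering by an edge below `e` does. -/

/-! ### Paths and routes -/

theorem isPath_append {l₁ l₂ : List E} {u w : Fin (n + 2)} :
    G.IsPath u (l₁ ++ l₂) w ↔ ∃ x, G.IsPath u l₁ x ∧ G.IsPath x l₂ w := by
  induction l₁ generalizing u with
  | nil => simp [IsPath]
  | cons a l ih => simp [IsPath, ih, and_assoc]

variable (G) in
theorem exists_isPath_from_source (v : Fin (n + 2)) : ∃ l, G.IsPath 0 l v := by
  induction v using WellFoundedLT.induction with
  | ind v ih =>
    by_cases h : v = 0
    · exact ⟨[], h.symm⟩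
    · obtain ⟨e, rfl⟩ := G.unique_source v h
      obtain ⟨l, hl⟩ := ih _ (G.src_lt_tgt e)
      exact ⟨l ++ [e], isPath_append.2 ⟨_, hl, rfl, rfl⟩⟩

variable (G) in
theorem exists_isPath_to_sink (v : Fin (n + 2)) : ∃ l, G.IsPath v l (Fin.last (n + 1)) := by
  induction v using WellFoundedGT.induction with
  | ind v ih =>
    by_cases h : v = Fin.last (n + 1)
    · exact ⟨[], h⟩
    · obtain ⟨e, rfl⟩ := G.unique_sink v h
      obtain ⟨l, hl⟩ := ih _ (G.src_lt_tgt e)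
      exact ⟨e :: l, rfl, hl⟩

/-- Every edge `e` into `v` and every edge `f` out of `v` lie consecutively on a route. -/
theorem exists_route_through {v : Fin (n + 2)} {e f : E} (he : G.tgt e = v) (hf : G.src f = v) :
    ∃ p q, G.IsPath 0 (p ++ [e]) v ∧ G.IsPath v (f :: q) (Fin.last (n + 1)) := by
  obtain ⟨p, hp⟩ := G.exists_isPath_from_source (G.src e)
  obtain ⟨q, hq⟩ := G.exists_isPath_to_sink (G.tgt f)
  exact ⟨p, q, isPath_append.2 ⟨_, hp, rfl, he⟩, hf, hq⟩

/-- A path is determined by its start and its set of edges. -/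
theorem IsPath.eq_of_mem_iff : ∀ {l l' : List E} {u w w' : Fin (n + 2)},
    G.IsPath u l w → G.IsPath u l' w' → (∀ e, e ∈ l ↔ e ∈ l') → l = l'
  | [], l', _, _, _, _, _, h => (List.eq_nil_iff_forall_not_mem.2 fun e he => by
      simpa using (h e).2 he).symm
  | a :: l, [], _, _, _, _, _, h => by simpa using (h a).1
  | a :: l, b :: l', u, w, w', h₁, h₂, h => by
    have hab : a = b := h₂.eq_of_src_eq a ((h a).1 (by simp)) b (by simp) (h₁.1.trans h₂.1.symm)
    subst hab
    -- All edges of a path from the head of `a` start strictly after the tail of `a`, so `a` does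
    -- not recur and can be cancelled on both sides.
    have key : ∀ {m : List E} {x}, G.IsPath (G.tgt a) m x → a ∉ m := fun hm ha =>
      ((hm.le_src a ha).trans_lt (G.src_lt_tgt a)).false
    have hl := key h₁.2
    have hl' := key h₂.2
    rw [h₁.2.eq_of_mem_iff h₂.2 fun e => ?_]
    have := h e
    simp only [List.mem_cons] at this
    by_cases hea : e = a
    · subst hea; simp [hl, hl']
    · simpa [hea] using this

/-! ### Indicator vectors as vertices of the unit cube -/

theorem chi_apply_of_mem {R : G.Route} {e : E} (h : e ∈ R.1) : G.chi R e = 1 :=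
  Set.indicator_of_mem (s := {e | e ∈ R.1}) h 1

theorem chi_apply_of_notMem {R : G.Route} {e : E} (h : e ∉ R.1) : G.chi R e = 0 :=
  Set.indicator_of_notMem (s := {e | e ∈ R.1}) h 1

theorem chi_apply_eq_one_iff {R : G.Route} {e : E} : G.chi R e = 1 ↔ e ∈ R.1 :=
  ⟨fun h => by_contra fun h' => by simp [chi_apply_of_notMem h'] at h, chi_apply_of_mem⟩

theorem chi_injective : Function.Injective G.chi := fun R Q h =>
  Subtype.ext <| R.2.eq_of_mem_iff Q.2 fun e => by
    rw [← chi_apply_eq_one_iff, h, chi_apply_eq_one_iff]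

theorem chi_mem_Icc (R : G.Route) : G.chi R ∈ Set.Icc (0 : E → ℝ) 1 := by
  constructor <;> intro e <;> by_cases h : e ∈ R.1 <;>
    simp [chi_apply_of_mem, chi_apply_of_notMem, h]

theorem convexHull_chi_subset_Icc (C : Set G.Route) :
    convexHull ℝ (G.chi '' C) ⊆ Set.Icc (0 : E → ℝ) 1 :=
  convexHull_min (Set.image_subset_iff.2 fun R _ => chi_mem_Icc R) (convex_Icc _ _)

/-- The indicator vector of a route is a vertex of the unit cube. -/
theorem chi_mem_extremePoints_Icc (R : G.Route) :
    G.chi R ∈ (Set.Icc (0 : E → ℝ) 1).extremePoints ℝ := by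
  refine ⟨chi_mem_Icc R, fun x hx y hy ⟨a, b, ha, hb, hab, h⟩ => funext fun e => ?_⟩
  have h' := congrFun h e
  have hx0 := hx.1 e
  have hx1 := hx.2 e
  have hy0 := hy.1 e
  have hy1 := hy.2 e
  simp only [Pi.add_apply, Pi.smul_apply, smul_eq_mul, Pi.zero_apply, Pi.one_apply] at *
  -- A proper convex combination of numbers in `[0, 1]` equals `0` or `1` only if both numbers do.
  by_cases he : e ∈ R.1
  · rw [chi_apply_of_mem he] at h' ⊢
    nlinarith
  · rw [chi_apply_of_notMem he] at h' ⊢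
    nlinarith

/-- The hull lies in the unit cube, so a vertex of the cube in it is extreme in the hull and hence
one of the generating points. This recovers a clique from its simplex as a point set. -/
theorem chi_mem_convexHull_iff {R : G.Route} {C : Set G.Route} :
    G.chi R ∈ convexHull ℝ (G.chi '' C) ↔ R ∈ C := by
  refine ⟨fun h => ?_, fun h => subset_convexHull ℝ _ (Set.mem_image_of_mem _ h)⟩
  have := extremePoints_convexHull_subset (inter_extremePoints_subset_extremePoints_of_subset
    (convexHull_chi_subset_Icc C) ⟨h, chi_mem_extremePoints_Icc R⟩)
  exact (chi_injective.mem_set_image).1 this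

/-! ### Maximal simplices -/

theorem subset_generatedComplex (S : Set (Set (E → ℝ))) : S ⊆ generatedComplex S :=
  fun A hA => ⟨A, hA, IsExposed.refl A⟩

/-- A face lies inside its generator, which itself belongs to the complex; maximality makes the two
equal. -/
theorem mem_of_maximal_generatedComplex {S : Set (Set (E → ℝ))} {σ : Set (E → ℝ)}
    (h : Maximal (· ∈ generatedComplex S) σ) : σ ∈ S := by
  obtain ⟨A, hA, hσ⟩ := h.prop
  exact h.eq_of_subset (subset_generatedComplex S hA) hσ.subset ▸ hA

theorem Framing.exists_maximal_isClique (F : G.Framing) (Q : G.Route) :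
    ∃ C : Set G.Route, Maximal F.IsClique C ∧ Q ∈ C := by
  obtain ⟨C, hQ, hC⟩ := zorn_subset_nonempty {C | F.IsClique C}
    (fun c hc hchain _ => ⟨⋃₀ c, (Set.pairwise_sUnion hchain.directedOn).2 fun s hs => hc hs,
      fun s hs => Set.subset_sUnion_of_mem hs⟩) {Q} (Set.pairwise_singleton _ _)
  exact ⟨C, hC, hQ rfl⟩

/-- The simplex spanned by a maximal clique is a maximal simplex of the DKK triangulation. -/
theorem Framing.maximal_convexHull_chi {F : G.Framing} {C : Set G.Route}
    (hC : Maximal F.IsClique C) :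
    Maximal (· ∈ F.dkkTriangulation) (convexHull ℝ (G.chi '' C)) := by
  refine ⟨subset_generatedComplex _ ⟨C, hC, rfl⟩, ?_⟩
  rintro B ⟨_, ⟨C', hC', rfl⟩, hB⟩ hCB
  have hCC' : C ⊆ C' := fun R hR =>
    chi_mem_convexHull_iff.1 (hB.subset (hCB (chi_mem_convexHull_iff.2 hR)))
  rw [hC.eq_of_subset hC'.prop hCC']
  exact hB.subset

/-- A maximal simplex is a full join `conv(τ ∪ Δ)`, not a proper face of one, so it contains `χ_R`.
It lies in the unit cube, where `χ_R` is already extreme. -/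
theorem RouteDecomposition.chi_mem_extremePoints_of_maximal [Fintype E]
    (D : G.RouteDecomposition) [LinearOrder D.routes] {R : G.Route} (hR : R ∈ D.routes)
    {σ : Set (E → ℝ)} (hσ : Maximal (· ∈ D.equatorialFlowTriangulation) σ) :
    G.chi R ∈ σ.extremePoints ℝ := by
  obtain ⟨τ, ⟨⟨_, ⟨C, -, rfl⟩, hτ⟩, -⟩, rfl⟩ := mem_of_maximal_generatedComplex hσ
  refine inter_extremePoints_subset_extremePoints_of_subset
    (convexHull_min (Set.union_subset (hτ.subset.trans (convexHull_chi_subset_Icc C))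
      (convexHull_chi_subset_Icc D.routes)) (convex_Icc _ _)) ⟨?_, chi_mem_extremePoints_Icc R⟩
  exact subset_convexHull ℝ _ (Or.inr (chi_mem_convexHull_iff.2 hR))

/-! ### Conflicts at a vertex of indegree at least three -/

theorem exists_lt_lt_of_three_le_card {α : Type*} [Fintype α] [LinearOrder α]
    (h : 3 ≤ Fintype.card α) : ∃ a b c : α, a < b ∧ b < c := by
  have e := Fintype.orderIsoFinOfCardEq α rfl
  exact ⟨e ⟨0, by omega⟩, e ⟨1, by omega⟩, e ⟨2, by omega⟩, by simp, by simp⟩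

theorem exists_ne_outEdge [Fintype E] (hidle : ∀ e : E, ¬ G.IsIdle e) (v : G.Inner) {f : E}
    (hf : G.src f = v) : ∃ f', G.src f' = v ∧ f' ≠ f := by
  by_contra! h
  refine hidle f ⟨v, Or.inr (Finset.eq_singleton_iff_unique_mem.2 ⟨?_, fun x hx => h x ?_⟩)⟩
  · simpa [outEdges] using hf
  · simpa [outEdges] using hx

/-- If the edge `e` of the route `R` into the inner vertex `v` is neither the smallest nor the
largest one, and `v` has another outgoing edge, then `R` conflicts with some other route. -/
theorem Framing.exists_conflict_of_lt_lt (F : G.Framing) {v : G.Inner}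
    {a e b : {e : E // G.tgt e = v}} (hae : (F.inOrder v).lt a e) (heb : (F.inOrder v).lt e b)
    (hout : ∀ f, G.src f = v → ∃ f', G.src f' = v ∧ f' ≠ f) {R : G.Route} (heR : e.1 ∈ R.1) :
    ∃ Q : G.Route, R ≠ Q ∧ F.Conflict R Q := by
  let _ := F.inOrder v
  let _ := F.outOrder v
  obtain ⟨p, q, hpq⟩ := List.append_of_mem heR
  rw [List.append_cons] at hpq
  have hR := R.2
  rw [hpq] at hR
  obtain ⟨x, hp, hq⟩ := isPath_append.1 hR
  have hx : x = v := by
    obtain ⟨_, _, _, rfl⟩ := isPath_append.1 hp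
    exact e.2
  subst hx
  match q, hq with
  -- `R` continues beyond `v`, because `v` is not the sink.
  | [], hq => exact absurd hq v.2.2
  | f :: q, hq =>
    obtain ⟨f', hf', hne⟩ := hout f hq.1
    let g : {e : E // G.src e = v} := ⟨f, hq.1⟩
    let g' : {e : E // G.src e = v} := ⟨f', hf'⟩
    -- A route has only one edge into `v`, so entering by `d ≠ e` yields a route other than `R`.
    have ne_route : ∀ {d : {e : E // G.tgt e = v}} {p' q' : List E}
        (h : G.IsPath 0 (p' ++ [d.1] ++ q') (Fin.last (n + 1))), d ≠ e → R ≠ ⟨_, h⟩ := by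
      rintro d p' q' h hd rfl
      exact hd (Subtype.ext (h.eq_of_tgt_eq _ (by simp) _ heR (d.2.trans e.2.symm)))
    -- The incoming edge is chosen on the side of `e` opposite to that of `f'` relative to `f`; this
    -- is where `e` needs neighbours on both sides.
    rcases lt_or_gt_of_ne (show g' ≠ g from fun h => hne (congrArg Subtype.val h)) with hg | hg
    · obtain ⟨p', q', hp', hq'⟩ := exists_route_through b.2 hf'
      exact ⟨⟨_, isPath_append.2 ⟨_, hp', hq'⟩⟩, ne_route _ (ne_of_gt heb), v, _, _, _, _,
        hpq, hp, hq, rfl, hp', hq', Or.inl ⟨⟨v, e, b, p, p', [], rfl, rfl, heb⟩,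
          ⟨v, g', g, [], q', q, rfl, rfl, hg⟩⟩⟩
    · obtain ⟨p', q', hp', hq'⟩ := exists_route_through a.2 hf'
      exact ⟨⟨_, isPath_append.2 ⟨_, hp', hq'⟩⟩, ne_route _ (ne_of_lt hae), v, _, _, _, _,
        hpq, hp, hq, rfl, hp', hq', Or.inr ⟨⟨v, a, e, p', p, [], rfl, rfl, hae⟩,
          ⟨v, g, g', [], q, q', rfl, rfl, hg⟩⟩⟩

/-- The condition `R ≠ Q` is kept because cliques only constrain pairs of distinct routes. -/
theorem RouteDecomposition.exists_conflict [Fintype E] (hidle : ∀ e : E, ¬ G.IsIdle e)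
    (D : G.RouteDecomposition) (v : G.Inner) (hv : 3 ≤ (G.inEdges v).card) (F : G.Framing) :
    ∃ R ∈ D.routes, ∃ Q : G.Route, R ≠ Q ∧ F.Conflict R Q := by
  classical
  let _ := F.inOrder v
  obtain ⟨a, e, b, hae, heb⟩ := exists_lt_lt_of_three_le_card (α := {e : E // G.tgt e = v})
    (by rwa [Fintype.card_subtype])
  exact ⟨_, (D.routeOf e.1).2, F.exists_conflict_of_lt_lt hae heb
    (fun f hf => exists_ne_outEdge hidle v hf) (D.mem_routeOf e.1)⟩

end FlowDAG

theorem mainTheorem3 {n : ℕ} {E : Type*} [Fintype E] (G : FlowDAG n E)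
    (hidle : ∀ e : E, ¬ G.IsIdle e)
    (D : G.RouteDecomposition) [LinearOrder D.routes]
    (v : G.Inner) (hv : 3 ≤ (G.inEdges v).card) :
    (∀ F : G.Framing, D.equatorialFlowTriangulation ≠ F.dkkTriangulation) ∧
    (∀ R ∈ D.routes, ∀ σ, Maximal (· ∈ D.equatorialFlowTriangulation) σ →
      G.chi R ∈ σ.extremePoints ℝ) ∧
    (∀ F : G.Framing, ∃ R ∈ D.routes, ∃ Q : G.Route, F.Conflict R Q) := by
  refine ⟨fun F heq => ?_, fun R hR σ hσ => D.chi_mem_extremePoints_of_maximal hR hσ, fun F => ?_⟩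
  · obtain ⟨R, hR, Q, hne, hRQ⟩ := D.exists_conflict hidle v hv F
    obtain ⟨C, hC, hQ⟩ := F.exists_maximal_isClique Q
    have hσ := FlowDAG.Framing.maximal_convexHull_chi hC
    rw [← heq] at hσ
    have hRC := FlowDAG.chi_mem_convexHull_iff.1 (D.chi_mem_extremePoints_of_maximal hR hσ).1
    exact hC.prop hRC hQ hne hRQ
  · obtain ⟨R, hR, Q, -, hRQ⟩ := D.exists_conflict hidle v hv F
    exact ⟨R, hR, Q, hRQ⟩
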